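/- Let $n\ge 2$, $m\ge 1$, let $0=a_0<a_1<\dots<a_m=1$, and let $\mathcal B:[0,1]\to\mathbb R^3$ be a simple (possibly closed), regular, $C^1$ composite Bézier curve whose $k$-th segment ($0\le k<m$), affinely parametrized by $[a_k,a_{k+1}]$, is the Bézier curve of degree $n$ with control points $p_{k,0},\dots,p_{k,n}$ (a single Bézier curve is the case $m=1$). Here regular means that $\mathcal B'$ never vanishes, and a curve on $[0,1]$ is simple if it takes no value twice, except that its initial and terminal points may coincide. Put $$p'_{k,j}=\frac{p_{k,j+1}-p_{k,j}}{(a_{k+1}-a_k)/n}\quad(0\le j<n),\qquad M=\max_{k,\;0\le j<n-1}\|p'_{k,j+1}-p'_{k,j}\|,\qquad \sigma=\min_{t\in[0,1]}\|\mathcal B'(t)\|.$$ Let $P$ and $P'$ be the families of the $p_{k,j}$ and of the $p'_{k,j}$. Let $\Delta_2P\in\mathbb R^3$ be the vector whose coordinates are the maxima over $k$ and $0<j<n$ of the absolute values of the respective coordinates of $p_{k,j-1}-2p_{k,j}+p_{k,j+1}$, and let $\Delta_2P'$ be defined in the same way from the $p'_{k,j}$, with $0<j<n-1$ (it is $0$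 if $n=2$). Put $$N_\infty(d)=\frac{\lfloor d/2\rfloor\lceil d/2\rceil}{2d},\qquad B'_{dist}(x)=\frac{1}{2^{2x}}N_\infty(n-1)\,\|\Delta_2P'\| .$$ Let $N_1$ be any real number with $B'_{dist}(N_1)<\sigma$, that is, $N_1>\frac12\log_2\big(N_\infty(n-1)\|\Delta_2P'\|/\sigma\big)$, and put $$f(\nu)=\frac{2M}{(1-\cos\nu)\,(\sigma-B'_{dist}(N_1))},\qquad N(\nu)=\big\lceil\max\{N_1,\log_2 f(\nu)\}\big\rceil .$$ Let $r>0$ be the radius of a non-self-intersecting pipe around $\mathcal B$: the closed discs $D_r(t)$ of radius $r$ centered at $\mathcal B(t)$ in the planes normal to $\mathcal B'(t)$ are pairwise disjoint for distinct $t\in[0,1]$ (except for $D_r(0)$ and $D_r(1)$ if $\mathcal B(0)=\mathcal B(1)$); the pipe surface consists of their boundary circles. Put $$N'(r)=\tfrac12\log_2\!\Big(\frac{N_\infty(n)\,\|\Delta_2P\|}{r}\Big),\qquad \hat N=\max\Big\{N\big(\tfrac{\pi}{2(n-1)}\big),\,N'(r)\Big\},$$ where $\log_2 0$ may be read as $0$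 or as $-\infty$. Then for every integer $i\ge 0$ with $i\ge\lceil\hat N\rceil$, the control polygon obtained from the $p_{k,j}$ by $i$ de Casteljau subdivisions with parameter $\frac12$ of every segment (the union of the control polygons of the $m2^i$ resulting segments) is simple and homeomorphic to $\mathcal B$. -/

import Mathlib

open Set

noncomputable section

/-- Euclidean three-space. -/
abbrev Space3 : Type := EuclideanSpace ℝ (Fin 3)

/-! ### Bézier curves

The control points of a Bézier curve of degree `n` are the values `p 0, …, p n` of a sequence `p`;
the further values of `p` are never used. Likewise a composite curve with `m` segments has the
control points `P k 0, …, P k n`, where `k < m`. -/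

/-- The Bézier curve of degree `n` with control points `p 0, …, p n`. -/
def bezier (n : ℕ) (p : ℕ → Space3) (t : ℝ) : Space3 :=
  ∑ j ∈ Finset.range (n + 1), ((n.choose j : ℝ) * t ^ j * (1 - t) ^ (n - j)) • p j

/-- `a` is a partition `0 = a 0 < a 1 < ⋯ < a m = 1` of the unit interval. -/
structure IsPartition (m : ℕ) (a : ℕ → ℝ) : Prop where
  first : a 0 = 0
  last : a m = 1
  lt : ∀ k < m, a k < a (k + 1)

/-- On `[0, 1]` the curve `γ` is the composite Bézier curve of degree `n` whose `k`-th segment,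
parametrized affinely by `[a k, a (k + 1)]`, has the control points `P k 0, …, P k n`. -/
def IsCompositeBezier (n m : ℕ) (a : ℕ → ℝ) (P : ℕ → ℕ → Space3) (γ : ℝ → Space3) : Prop :=
  ∀ k < m, ∀ s ∈ Icc (0 : ℝ) 1, γ (a k + s * (a (k + 1) - a k)) = bezier n (P k) s

/-- The derivative of a curve parametrized by `[0, 1]` (one-sided at the end points). -/
def velocity (γ : ℝ → Space3) (t : ℝ) : Space3 := derivWithin γ (Icc 0 1) t

/-- The derivative never vanishes. -/
def IsRegularCurve (γ : ℝ → Space3) : Prop := ∀ t ∈ Icc (0 : ℝ) 1, velocity γ t ≠ 0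

/-- A curve on `[0, 1]`, open or closed, without self-intersections: no value is taken twice,
except that the initial point of the curve may be its terminal point. -/
def IsSimpleCurve (γ : ℝ → Space3) : Prop :=
  ∀ s ∈ Icc (0 : ℝ) 1, ∀ t ∈ Icc (0 : ℝ) 1, s < t → γ s = γ t → s = 0 ∧ t = 1

/-! ### Subdivision -/

/-- Iterated midpoints of the de Casteljau algorithm with parameter `1 / 2`. -/
def casteljau (p : ℕ → Space3) : ℕ → ℕ → Space3
  | 0, j => p j
  | l + 1, j => midpoint ℝ (casteljau p l j) (casteljau p l (j + 1))

/-- Control points of the first half of a Bézier curve. -/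
def leftHalf (p : ℕ → Space3) (j : ℕ) : Space3 := casteljau p j 0

/-- Control points of the second half of a Bézier curve of degree `n`. -/
def rightHalf (n : ℕ) (p : ℕ → Space3) (j : ℕ) : Space3 := casteljau p (n - j) j

/-- One subdivision: segment `k` is replaced by its halves, numbered `2 * k` and `2 * k + 1`. -/
def subdivide (n : ℕ) (P : ℕ → ℕ → Space3) (k : ℕ) : ℕ → Space3 :=
  if k % 2 = 0 then leftHalf (P (k / 2)) else rightHalf n (P (k / 2))

/-- The vertices, in order, of the union of the control polygons of `m` consecutive segments of
degree `n`; they are numbered `0, …, n * m`. -/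
def vertices (n m : ℕ) (P : ℕ → ℕ → Space3) (v : ℕ) : Space3 :=
  if v < n * m then P (v / n) (v % n) else P (m - 1) n

/-- The uniform parametrization over `[0, 1]` of the PL curve with vertices `v 0, …, v N`: it takes
the value `v j` at `j / N` and is affine in between. -/
def polyline (N : ℕ) (v : ℕ → Space3) (t : ℝ) : Space3 :=
  AffineMap.lineMap (v ⌊(N : ℝ) * t⌋₊) (v (⌊(N : ℝ) * t⌋₊ + 1))
    ((N : ℝ) * t - (⌊(N : ℝ) * t⌋₊ : ℝ))

/-- The control polygon after `i` subdivisions, that is, the union of the control polygons of all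
the `m * 2 ^ i` segments obtained, uniformly parametrized over `[0, 1]`. -/
def controlPolygon (n m : ℕ) (P : ℕ → ℕ → Space3) (i : ℕ) : ℝ → Space3 :=
  polyline (n * (m * 2 ^ i)) (vertices n (m * 2 ^ i) ((subdivide n)^[i] P))

/-! ### Pipes -/

/-- The normal disc of radius `r` of the curve `γ` at parameter `t`. -/
def normalDisc (γ : ℝ → Space3) (r t : ℝ) : Set Space3 :=
  {x | inner ℝ (x - γ t) (velocity γ t) = 0 ∧ dist x (γ t) ≤ r}

/-- The pipe of radius `r` around `γ` does not intersect itself: normal discs at different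
parameters are disjoint, except for the two discs at the common end point of a closed curve. The
pipe surface is formed by the boundary circles of these discs. -/
def PipeNonSelfIntersecting (γ : ℝ → Space3) (r : ℝ) : Prop :=
  ∀ s ∈ Icc (0 : ℝ) 1, ∀ t ∈ Icc (0 : ℝ) 1, s < t →
    Disjoint (normalDisc γ r s) (normalDisc γ r t) ∨ (s = 0 ∧ t = 1 ∧ γ 0 = γ 1)

/-! ### Constants -/

/-- `N_∞(n) = ⌊n / 2⌋ ⌈n / 2⌉ / (2 n)`. -/
def NInfty (n : ℕ) : ℝ := (⌊(n : ℝ) / 2⌋ : ℝ) * (⌈(n : ℝ) / 2⌉ : ℝ) / (2 * n)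

/-- The vector `Δ₂ P` of the coordinatewise maximal absolute second differences of the control
points of `m` segments of degree `d` (`0` if `d ≤ 1`, when there are no second differences). -/
def secondDifference (d m : ℕ) (P : ℕ → ℕ → Space3) : Space3 :=
  WithLp.toLp 2 fun c : Fin 3 =>
    ⨆ q : Fin m × Fin (d - 1), |P q.1 q.2 c - 2 * P q.1 (q.2 + 1) c + P q.1 (q.2 + 2) c|

/-- The discrete derivative `P'`, consisting of the `n` points
`P' k j = (P k (j + 1) - P k j) / (t (j + 1) - t j)`, `0 ≤ j < n`, for each segment `k`, where
`t j = a k + (a (k + 1) - a k) * j / n`. -/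
def discreteDerivative (n : ℕ) (a : ℕ → ℝ) (P : ℕ → ℕ → Space3) (k j : ℕ) : Space3 :=
  ((a (k + 1) - a k) / n)⁻¹ • (P k (j + 1) - P k j)

/-- `M`, the maximal distance of consecutive vertices of `P'`. -/
def maxStep (n m : ℕ) (a : ℕ → ℝ) (P : ℕ → ℕ → Space3) : ℝ :=
  ⨆ q : Fin m × Fin (n - 1),
    dist (discreteDerivative n a P q.1 q.2) (discreteDerivative n a P q.1 (q.2 + 1))

/-- `σ`, the minimal speed of the curve. -/
def minSpeed (γ : ℝ → Space3) : ℝ := sInf ((fun t => ‖velocity γ t‖) '' Icc 0 1)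

/-- `B'_dist(x) = 2 ^ (-2 x) N_∞(n - 1) ‖Δ₂ P'‖`. -/
def derivDistBound (n m : ℕ) (a : ℕ → ℝ) (P : ℕ → ℕ → Space3) (x : ℝ) : ℝ :=
  1 / (2 : ℝ) ^ (2 * x) *
    (NInfty (n - 1) * ‖secondDifference (n - 1) m (discreteDerivative n a P)‖)

/-- `f(ν) = 2 M / ((1 - cos ν) (σ - B'_dist(N₁)))`. -/
def angleFactor (n m : ℕ) (a : ℕ → ℝ) (P : ℕ → ℕ → Space3) (γ : ℝ → Space3) (N₁ ν : ℝ) : ℝ :=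
  2 * maxStep n m a P / ((1 - Real.cos ν) * (minSpeed γ - derivDistBound n m a P N₁))

/-- `N(ν) = ⌈max {N₁, log₂ f(ν)}⌉`. The value `logb 2 0 = 0`, instead of `-∞`, is harmless here and
below, because numbers of subdivisions are nonnegative. -/
def angleIterations (n m : ℕ) (a : ℕ → ℝ) (P : ℕ → ℕ → Space3) (γ : ℝ → Space3) (N₁ ν : ℝ) : ℤ :=
  ⌈max N₁ (Real.logb 2 (angleFactor n m a P γ N₁ ν))⌉

/-- `N'(r) = log₂ (N_∞(n) ‖Δ₂ P‖ / r) / 2`. -/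
def distIterations (n m : ℕ) (P : ℕ → ℕ → Space3) (r : ℝ) : ℝ :=
  1 / 2 * Real.logb 2 (NInfty n * ‖secondDifference n m P‖ / r)

/-- `max {N(π / (2 (n - 1))), N'(r)}`. -/
def homeoIterations (n m : ℕ) (a : ℕ → ℝ) (P : ℕ → ℕ → Space3) (γ : ℝ → Space3) (N₁ r : ℝ) : ℝ :=
  max (angleIterations n m a P γ N₁ (Real.pi / (2 * ((n : ℝ) - 1))) : ℝ) (distIterations n m P r)

end

/-! Subdivision shrinks `d`-th differences of control points by `2 ^ d`, and halves parameter
intervals. This has two effects.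

Distance: the Bernstein average reproduces affine functions, so curve and control polygon differ at
equal parameters by at most `N_∞` times the second differences (`dist_bezier_polyline_le`). The gap
falls by `4` per step and is eventually at most `r`.

Angles: `P'` is the control polygon of the velocity, so its points are eventually bounded below in
norm by `σ - B'_dist(N₁)`, while its steps shrink like `2 ^ (-i)`. Consecutive edges then turn by
less than `π / (2 (n - 1))`, so any two edges of one segment's polygon form an acute angle
(`inner_subdivide_pos`).

Acute angles make each segment's polygon advance strictly along each of its edges, hence injective.
The point of a curve piece nearest to a polygon point `x` is interior, so that `x` lies in its
normal disc, or an end point; in the latter case monotonicity forces `x` to be that end point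
(`exists_mem_normalDisc`). A coincidence between different segments would make discs at distinct
parameters meet, contrary to the pipe hypothesis, except at the ends of a closed curve.

Polygon and curve, both simple with equal ends, identify the same parameters; their images are the
same quotient of `[0, 1]`. -/

/-! ### Bézier curves as images of powers of linear polynomials -/

/-- The linear map on polynomials that sends `X ^ j` to the control point `p j`. -/
noncomputable def controlMap (p : ℕ → Space3) : Polynomial ℝ →ₗ[ℝ] Space3 :=
  Polynomial.lsum fun j => LinearMap.toSpanSingleton ℝ Space3 (p j)

lemma controlMap_monomial (p : ℕ → Space3) (j : ℕ) (c : ℝ) :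
    controlMap p (Polynomial.monomial j c) = c • p j := by
  simp [controlMap, Polynomial.lsum_apply, Polynomial.sum_monomial_index]

lemma controlMap_X_pow (p : ℕ → Space3) (j : ℕ) : controlMap p (Polynomial.X ^ j) = p j := by
  rw [Polynomial.X_pow_eq_monomial, controlMap_monomial, one_smul]

lemma controlMap_X_mul (p : ℕ → Space3) (q : Polynomial ℝ) :
    controlMap p (Polynomial.X * q) = controlMap (fun j => p (j + 1)) q := by
  induction q using Polynomial.induction_on' with
  | add f g hf hg => rw [mul_add, map_add, map_add, hf, hg]
  | monomial j c => rw [Polynomial.X_mul_monomial, controlMap_monomial, controlMap_monomial]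

lemma controlMap_sub (p q : ℕ → Space3) (f : Polynomial ℝ) :
    controlMap (fun j => p j - q j) f = controlMap p f - controlMap q f := by
  induction f using Polynomial.induction_on' with
  | add f g hf hg => rw [map_add, map_add, map_add, hf, hg]; abel
  | monomial j c => simp only [controlMap_monomial, smul_sub]

/-- The binomial theorem under a linear map. General `A` and `B` cover the curve itself and both of
its halves. -/
lemma sum_bernstein_smul (L : Polynomial ℝ →ₗ[ℝ] Space3) (A B : Polynomial ℝ) (n : ℕ) (s : ℝ) :
    ∑ j ∈ Finset.range (n + 1),
        ((n.choose j : ℝ) * s ^ j * (1 - s) ^ (n - j)) • L (A ^ j * B ^ (n - j)) =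
      L ((s • A + (1 - s) • B) ^ n) := by
  rw [add_pow, map_sum]
  refine Finset.sum_congr rfl fun j _ => ?_
  rw [← map_smul]
  congr 1
  simp only [Polynomial.smul_eq_C_mul, map_mul, map_pow, map_natCast, mul_pow]
  ring

lemma bezier_eq_controlMap (n : ℕ) (p : ℕ → Space3) (t : ℝ) :
    bezier n p t = controlMap p ((t • Polynomial.X + (1 - t) • 1) ^ n) := by
  rw [← sum_bernstein_smul, bezier]
  simp only [one_pow, mul_one, controlMap_X_pow]

/-- Taking midpoints of neighbours is multiplication by `(1 + X) / 2`. -/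
lemma casteljau_eq_controlMap (p : ℕ → Space3) (l j : ℕ) :
    casteljau p l j =
      controlMap p (((1 / 2 : ℝ) • (1 + Polynomial.X)) ^ l * Polynomial.X ^ j) := by
  induction l generalizing j with
  | zero => simp [casteljau, controlMap_X_pow]
  | succ l ih =>
    rw [casteljau, ih, ih, midpoint_eq_smul_add, ← map_add, ← map_smul]
    congr 1
    simp only [Polynomial.smul_eq_C_mul, invOf_eq_inv, one_div]
    ring

lemma bezier_leftHalf (n : ℕ) (p : ℕ → Space3) (s : ℝ) :
    bezier n (leftHalf p) s = bezier n p (s / 2) := by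
  have h := sum_bernstein_smul (controlMap p) ((1 / 2 : ℝ) • (1 + Polynomial.X)) 1 n s
  rw [bezier_eq_controlMap n p, bezier]
  simp only [leftHalf, casteljau_eq_controlMap]
  simp only [one_pow, pow_zero] at h ⊢
  rw [h]
  congr 2
  module

lemma bezier_rightHalf (n : ℕ) (p : ℕ → Space3) (s : ℝ) :
    bezier n (rightHalf n p) s = bezier n p ((1 + s) / 2) := by
  have h := sum_bernstein_smul (controlMap p) Polynomial.X ((1 / 2 : ℝ) • (1 + Polynomial.X)) n s
  rw [bezier_eq_controlMap n p, bezier]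
  refine (Finset.sum_congr rfl fun j _ => ?_).trans (h.trans ?_)
  · rw [rightHalf, casteljau_eq_controlMap, mul_comm (_ ^ (n - j))]
  · congr 2
    module

lemma bezier_succ (n : ℕ) (p : ℕ → Space3) (t : ℝ) :
    bezier (n + 1) p t = (1 - t) • bezier n p t + t • bezier n (fun j => p (j + 1)) t := by
  rw [bezier_eq_controlMap, bezier_eq_controlMap, bezier_eq_controlMap, ← controlMap_X_mul,
    ← map_smul, ← map_smul, ← map_add]
  congr 1
  simp only [Polynomial.smul_eq_C_mul]
  ring

lemma bezier_fwdDiff (n : ℕ) (p : ℕ → Space3) (t : ℝ) :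
    bezier n (fwdDiff 1 p) t = bezier n (fun j => p (j + 1)) t - bezier n p t := by
  simp only [bezier_eq_controlMap]
  exact controlMap_sub _ _ _

lemma bezier_smul (n : ℕ) (c : ℝ) (p : ℕ → Space3) (t : ℝ) :
    bezier n (fun j => c • p j) t = c • bezier n p t := by
  simp only [bezier, Finset.smul_sum]
  exact Finset.sum_congr rfl fun j _ => smul_comm _ _ _

lemma hasDerivAt_bezier (n : ℕ) (p : ℕ → Space3) (t : ℝ) :
    HasDerivAt (bezier (n + 1) p) (((n : ℝ) + 1) • bezier n (fwdDiff 1 p) t) t := by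
  induction n generalizing p with
  | zero =>
    have h : bezier (0 + 1) p = fun t => (1 - t) • p 0 + t • p 1 := by
      funext t; simp [Finset.sum_range_succ, bezier]
    rw [h]
    refine ((((hasDerivAt_id t).const_sub 1).smul_const (p 0)).add
      ((hasDerivAt_id t).smul_const (p 1))).congr_deriv ?_
    simp [bezier, fwdDiff]
    module
  | succ n ih =>
    have h : bezier (n + 1 + 1) p =
        fun t => (1 - t) • bezier (n + 1) p t + t • bezier (n + 1) (fun j => p (j + 1)) t := by
      funext t; exact bezier_succ _ _ _
    rw [h]
    refine ((((hasDerivAt_id t).const_sub 1).smul (ih p)).add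
      ((hasDerivAt_id t).smul (ih fun j => p (j + 1)))).congr_deriv ?_
    rw [bezier_fwdDiff (n + 1), bezier_succ n p, bezier_succ n (fun j => p (j + 1)),
      bezier_fwdDiff, bezier_fwdDiff]
    simp only [id]
    push_cast
    module

lemma bezier_zero (n : ℕ) (p : ℕ → Space3) : bezier n p 0 = p 0 := by
  simp [bezier_eq_controlMap, ← controlMap_X_pow p 0]

lemma bezier_one (n : ℕ) (p : ℕ → Space3) : bezier n p 1 = p n := by
  simp [bezier_eq_controlMap, controlMap_X_pow]

/-! ### Differences under subdivision -/

lemma casteljau_fwdDiff (p : ℕ → Space3) (l j : ℕ) :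
    casteljau (fwdDiff 1 p) l j = casteljau p l (j + 1) - casteljau p l j := by
  induction l generalizing j with
  | zero => rfl
  | succ l ih =>
    simp only [casteljau, ih, midpoint_eq_smul_add]
    module

lemma fwdDiff_leftHalf (p : ℕ → Space3) (j : ℕ) :
    leftHalf p (j + 1) - leftHalf p j = (1 / 2 : ℝ) • leftHalf (fwdDiff 1 p) j := by
  simp only [leftHalf, casteljau_fwdDiff, casteljau, midpoint_eq_smul_add, invOf_eq_inv]
  module

lemma fwdDiff_rightHalf {n j : ℕ} (p : ℕ → Space3) (hj : j < n) :
    rightHalf n p (j + 1) - rightHalf n p j =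
      (1 / 2 : ℝ) • rightHalf (n - 1) (fwdDiff 1 p) j := by
  obtain ⟨l, rfl⟩ := Nat.exists_eq_add_of_lt hj
  have h1 : j + l + 1 - (j + 1) = l := by omega
  have h2 : j + l + 1 - j = l + 1 := by omega
  have h3 : j + l + 1 - 1 - j = l := by omega
  simp only [rightHalf, h1, h2, h3, casteljau_fwdDiff, casteljau, midpoint_eq_smul_add,
    invOf_eq_inv]
  module

lemma fwdDiff_subdivide {n j : ℕ} (P : ℕ → ℕ → Space3) (k : ℕ) (hj : j < n) :
    subdivide n P k (j + 1) - subdivide n P k j =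
      (1 / 2 : ℝ) • subdivide (n - 1) (fun k => fwdDiff 1 (P k)) k j := by
  unfold subdivide
  split_ifs
  · exact fwdDiff_leftHalf _ _
  · exact fwdDiff_rightHalf _ hj

lemma fwdDiff_iterate_subdivide {n d j : ℕ} (P : ℕ → ℕ → Space3) (k : ℕ) (hj : j + d ≤ n) :
    (fwdDiff 1)^[d] (subdivide n P k) j =
      (1 / 2 : ℝ) ^ d • subdivide (n - d) (fun k => (fwdDiff 1)^[d] (P k)) k j := by
  induction d generalizing j with
  | zero => simp
  | succ d ih =>
    rw [Function.iterate_succ_apply', fwdDiff, ih (by omega), ih (by omega), ← smul_sub,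
      fwdDiff_subdivide _ _ (by omega), smul_smul, ← pow_succ, Nat.sub_sub]
    simp only [Function.iterate_succ_apply']

lemma seminorm_casteljau_le (ψ : Seminorm ℝ Space3) {C : ℝ} (p : ℕ → Space3) (l j : ℕ)
    (h : ∀ i ≤ l + j, ψ (p i) ≤ C) : ψ (casteljau p l j) ≤ C := by
  induction l generalizing j with
  | zero => exact h j (by omega)
  | succ l ih =>
    have h1 := ih j fun i hi => h i (by omega)
    have h2 := ih (j + 1) fun i hi => h i (by omega)
    rw [casteljau, midpoint_eq_smul_add, map_smul_eq_mul]
    have h3 := map_add_le_add ψ (casteljau p l j) (casteljau p l (j + 1))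
    have h4 : ‖(⅟2 : ℝ)‖ = 1 / 2 := by norm_num
    rw [h4]
    linarith

lemma seminorm_subdivide_le (ψ : Seminorm ℝ Space3) {C : ℝ} {n j : ℕ} (P : ℕ → ℕ → Space3) (k : ℕ)
    (h : ∀ i ≤ n, ψ (P (k / 2) i) ≤ C) (hj : j ≤ n) : ψ (subdivide n P k j) ≤ C := by
  unfold subdivide
  split_ifs
  · exact seminorm_casteljau_le ψ _ _ _ fun i hi => h i (by omega)
  · exact seminorm_casteljau_le ψ _ _ _ fun i hi => h i (by omega)

lemma seminorm_fwdDiff_subdivide_le (ψ : Seminorm ℝ Space3) {n m d : ℕ} {P : ℕ → ℕ → Space3}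
    {C : ℕ → ℝ} (h : ∀ k < m, ∀ j, j + d ≤ n → ψ ((fwdDiff 1)^[d] (P k) j) ≤ C k) :
    ∀ k < m * 2, ∀ j, j + d ≤ n →
      ψ ((fwdDiff 1)^[d] (subdivide n P k) j) ≤ (1 / 2) ^ d * C (k / 2) := by
  intro k hk j hj
  rw [fwdDiff_iterate_subdivide P k hj, map_smul_eq_mul, norm_pow,
    show ‖(1 / 2 : ℝ)‖ = 1 / 2 by norm_num]
  gcongr
  exact seminorm_subdivide_le ψ _ _ (fun i hi => h _ (by omega) i (by omega)) (by omega)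

/-- The bound may depend on the ancestor `k / 2 ^ i` because the intervals of the partition differ
in length. Seminorms treat coordinates and the norm together. -/
lemma seminorm_fwdDiff_iterate_subdivide_le (ψ : Seminorm ℝ Space3) {n m d : ℕ}
    {P : ℕ → ℕ → Space3} {C : ℕ → ℝ}
    (h : ∀ k < m, ∀ j, j + d ≤ n → ψ ((fwdDiff 1)^[d] (P k) j) ≤ C k) (i : ℕ) :
    ∀ k < m * 2 ^ i, ∀ j, j + d ≤ n →
      ψ ((fwdDiff 1)^[d] ((subdivide n)^[i] P k) j) ≤ ((1 / 2) ^ d) ^ i * C (k / 2 ^ i) := by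
  induction i with
  | zero => simpa using h
  | succ i ih =>
    rw [pow_succ, ← mul_assoc]
    simp only [Function.iterate_succ_apply']
    intro k hk j hj
    refine (seminorm_fwdDiff_subdivide_le ψ ih k hk j hj).trans_eq ?_
    rw [Nat.div_div_eq_div_mul, pow_succ', mul_assoc, mul_comm 2]

/-! ### Refinement of the partition -/

/-- The partition refined by the midpoints of its intervals. -/
noncomputable def bisect (a : ℕ → ℝ) (k : ℕ) : ℝ :=
  if k % 2 = 0 then a (k / 2) else (a (k / 2) + a (k / 2 + 1)) / 2

lemma bisect_sub (a : ℕ → ℝ) (k : ℕ) :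
    bisect a (k + 1) - bisect a k = (a (k / 2 + 1) - a (k / 2)) / 2 := by
  unfold bisect
  rcases Nat.mod_two_eq_zero_or_one k with h | h
  · rw [if_neg (by omega), if_pos h, show (k + 1) / 2 = k / 2 by omega]
    ring
  · rw [if_pos (by omega), if_neg (by omega), show (k + 1) / 2 = k / 2 + 1 by omega]
    ring

lemma bisect_iterate_sub (a : ℕ → ℝ) (i k : ℕ) :
    bisect^[i] a (k + 1) - bisect^[i] a k = (a (k / 2 ^ i + 1) - a (k / 2 ^ i)) / 2 ^ i := by
  induction i generalizing k with
  | zero => simp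
  | succ i ih =>
    rw [Function.iterate_succ_apply', bisect_sub, ih, Nat.div_div_eq_div_mul, div_div, pow_succ,
      pow_succ, mul_comm 2 (2 ^ i)]

lemma IsPartition.refine_bisect {m : ℕ} {a : ℕ → ℝ} (ha : IsPartition m a) :
    IsPartition (m * 2) (bisect a) where
  first := by simp [bisect, ha.first]
  last := by simp [bisect, ha.last]
  lt k hk := by
    have h := bisect_sub a k
    have := ha.lt (k / 2) (by omega)
    linarith

lemma IsCompositeBezier.refine_subdivide {n m : ℕ} {a : ℕ → ℝ} {P : ℕ → ℕ → Space3} {γ : ℝ → Space3}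
    (h : IsCompositeBezier n m a P γ) :
    IsCompositeBezier n (m * 2) (bisect a) (subdivide n P) γ := by
  intro k hk s hs
  rw [bisect_sub]
  unfold bisect subdivide
  split_ifs with hk2
  · rw [bezier_leftHalf, ← h (k / 2) (by omega) _ ⟨by linarith [hs.1], by linarith [hs.2]⟩]
    congr 1
    ring
  · rw [bezier_rightHalf, ← h (k / 2) (by omega) _ ⟨by linarith [hs.1], by linarith [hs.2]⟩]
    congr 1
    ring

lemma IsPartition.bisect_iterate {m : ℕ} {a : ℕ → ℝ} (ha : IsPartition m a) (i : ℕ) :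
    IsPartition (m * 2 ^ i) (bisect^[i] a) := by
  induction i with
  | zero => simpa using ha
  | succ i ih =>
    rw [Function.iterate_succ_apply', pow_succ, ← mul_assoc]
    exact ih.refine_bisect

lemma IsCompositeBezier.subdivide_iterate {n m : ℕ} {a : ℕ → ℝ} {P : ℕ → ℕ → Space3}
    {γ : ℝ → Space3} (h : IsCompositeBezier n m a P γ) (i : ℕ) :
    IsCompositeBezier n (m * 2 ^ i) (bisect^[i] a) ((subdivide n)^[i] P) γ := by
  induction i with
  | zero => simpa using h
  | succ i ih =>
    rw [Function.iterate_succ_apply', Function.iterate_succ_apply', pow_succ, ← mul_assoc]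
    exact ih.refine_subdivide

/-! ### Polylines -/

lemma polyline_apply {N : ℕ} (v : ℕ → Space3) (j : ℕ) {f t : ℝ} (hf : f ∈ Icc (0 : ℝ) 1)
    (ht : (N : ℝ) * t = j + f) : polyline N v t = AffineMap.lineMap (v j) (v (j + 1)) f := by
  rw [polyline, ht]
  rcases hf.2.lt_or_eq with h | h
  · have : ⌊(j : ℝ) + f⌋₊ = j := by
      rw [Nat.floor_eq_iff (by linarith [hf.1, (Nat.cast_nonneg j : (0 : ℝ) ≤ j)])]
      constructor <;> linarith [hf.1]
    rw [this, add_sub_cancel_left]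
  · have : ⌊(j : ℝ) + f⌋₊ = j + 1 := by
      rw [h]; exact_mod_cast Nat.floor_natCast (R := ℝ) (j + 1)
    rw [this, h]
    simp

/-- The fractional part `f = 1` is needed only for `t = 1`, which has no edge to its right. -/
lemma exists_eq_add_of_mem_Icc {N : ℕ} (hN : 0 < N) {t : ℝ} (ht : t ∈ Icc (0 : ℝ) 1) :
    ∃ j < N, ∃ f ∈ Icc (0 : ℝ) 1, (N : ℝ) * t = j + f ∧ (f = 1 → j + 1 = N) := by
  have hN' : (0 : ℝ) < N := by exact_mod_cast hN
  have h0 : 0 ≤ (N : ℝ) * t := mul_nonneg hN'.le ht.1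
  rcases ht.2.lt_or_eq with h | h
  · refine ⟨⌊(N : ℝ) * t⌋₊, ?_, (N : ℝ) * t - ⌊(N : ℝ) * t⌋₊, ⟨?_, ?_⟩, by ring, ?_⟩
    · rw [Nat.floor_lt h0]; nlinarith
    · linarith [Nat.floor_le h0]
    · linarith [Nat.lt_floor_add_one ((N : ℝ) * t)]
    · intro h1; linarith [Nat.lt_floor_add_one ((N : ℝ) * t)]
  · refine ⟨N - 1, by omega, 1, by simp, ?_, fun _ => by omega⟩
    rw [Nat.cast_sub hN, h]
    simp

lemma continuousOn_polyline {N : ℕ} (hN : 0 < N) (v : ℕ → Space3) :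
    ContinuousOn (polyline N v) (Icc 0 1) := by
  have hN' : (0 : ℝ) < N := by exact_mod_cast hN
  have h : ContinuousOn (polyline N v)
      (⋃ j : Fin N, (fun t : ℝ => (N : ℝ) * t) ⁻¹' Icc (j : ℝ) (j + 1)) := by
    refine (locallyFinite_of_finite _).continuousOn_iUnion
      (fun j => isClosed_Icc.preimage (by fun_prop)) fun j => ?_
    have h1 : ContinuousOn (fun t : ℝ => AffineMap.lineMap (v j) (v (j + 1)) ((N : ℝ) * t - j))
        ((fun t : ℝ => (N : ℝ) * t) ⁻¹' Icc (j : ℝ) (j + 1)) := by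
      refine Continuous.continuousOn ?_
      exact AffineMap.lineMap_continuous.comp (by fun_prop)
    refine h1.congr fun t ht => ?_
    exact polyline_apply v j ⟨by linarith [ht.1], by linarith [ht.2]⟩ (by ring)
  refine h.mono fun t ht => ?_
  obtain ⟨j, hj, f, hf, hjf, -⟩ := exists_eq_add_of_mem_Icc hN ht
  simp only [mem_iUnion, mem_preimage]
  exact ⟨⟨j, hj⟩, by simp only; rw [hjf]; linarith [hf.1], by simp only; rw [hjf]; linarith [hf.2]⟩

/-- A polyline whose edges all have a positive component along `w` advances strictly along `w`. -/
lemma inner_polyline_lt {N : ℕ} (hN : 0 < N) (v : ℕ → Space3) (w : Space3)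
    (h : ∀ j < N, 0 < inner ℝ (v (j + 1) - v j) w) {s t : ℝ} (hs : s ∈ Icc (0 : ℝ) 1)
    (ht : t ∈ Icc (0 : ℝ) 1) (hst : s < t) :
    inner ℝ (polyline N v s) w < inner ℝ (polyline N v t) w := by
  have hN' : (0 : ℝ) < N := by exact_mod_cast hN
  obtain ⟨i, hi, f, hf, hif, hf1⟩ := exists_eq_add_of_mem_Icc hN hs
  obtain ⟨j, hj, g, hg, hjg, -⟩ := exists_eq_add_of_mem_Icc hN ht
  have hlt : (i : ℝ) + f < j + g := by rw [← hif, ← hjg]; exact mul_lt_mul_of_pos_left hst hN'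
  have hmono : ∀ a b : ℕ, a ≤ b → b ≤ N → inner ℝ (v a) w ≤ inner ℝ (v b) w := by
    intro a b hab
    induction b, hab using Nat.le_induction with
    | base => intro _; exact le_rfl
    | succ b hab ih =>
      intro hb
      have := h b (by omega)
      rw [inner_sub_left] at this
      linarith [ih (by omega)]
  rw [polyline_apply v i hf hif, polyline_apply v j hg hjg]
  simp only [AffineMap.lineMap_apply, vsub_eq_sub, vadd_eq_add, inner_add_left, real_inner_smul_left]
  have hei := h i hi
  have hej := h j hj
  rcases lt_trichotomy i j with hij | hij | hij
  -- Strictness comes from the unused part `1 - f` of edge `i`, since `g` may vanish.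
  · have hf' : f < 1 := lt_of_le_of_ne hf.2 fun h1 => by have := hf1 h1; omega
    have h1 := hmono (i + 1) j (by omega) (by omega)
    have h2 : inner ℝ (v (i + 1)) w = inner ℝ (v (i + 1) - v i) w + inner ℝ (v i) w := by
      rw [inner_sub_left]; ring
    nlinarith [hg.1, mul_nonneg hg.1 hej.le]
  · subst hij
    nlinarith
  · have : (j : ℝ) + 1 ≤ i := by exact_mod_cast hij
    linarith [hf.1, hg.2]

/-! ### Distance between a Bézier curve and its control polygon -/

lemma sum_bernstein (n : ℕ) (t : ℝ) :
    ∑ j ∈ Finset.range (n + 1), (n.choose j : ℝ) * t ^ j * (1 - t) ^ (n - j) = 1 := by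
  have := congrArg (Polynomial.eval t) (bernsteinPolynomial.sum ℝ n)
  simpa [Polynomial.eval_finsetSum, bernsteinPolynomial] using this

lemma sum_bernstein_mul (n : ℕ) (t : ℝ) :
    ∑ j ∈ Finset.range (n + 1), (n.choose j : ℝ) * t ^ j * (1 - t) ^ (n - j) * j = n * t := by
  have := congrArg (Polynomial.eval t) (bernsteinPolynomial.sum_smul ℝ n)
  simp only [Polynomial.eval_finsetSum, bernsteinPolynomial, nsmul_eq_mul, Polynomial.eval_mul,
    Polynomial.eval_pow, Polynomial.eval_sub, Polynomial.eval_one, Polynomial.eval_natCast,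
    Polynomial.eval_X] at this
  rw [← this]
  exact Finset.sum_congr rfl fun j _ => by ring

lemma sum_bernstein_mul_mul (n : ℕ) (t : ℝ) :
    ∑ j ∈ Finset.range (n + 1),
      (n.choose j : ℝ) * t ^ j * (1 - t) ^ (n - j) * ((j : ℝ) * (j - 1)) = n * (n - 1) * t ^ 2 := by
  have := congrArg (Polynomial.eval t) (bernsteinPolynomial.sum_mul_smul ℝ n)
  have hc : ∀ j : ℕ, ((j * (j - 1) : ℕ) : ℝ) = j * (j - 1) := by
    intro j; cases j <;> simp
  simp only [Polynomial.eval_finsetSum, bernsteinPolynomial, nsmul_eq_mul, Polynomial.eval_mul,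
    Polynomial.eval_pow, Polynomial.eval_sub, Polynomial.eval_one, Polynomial.eval_natCast,
    Polynomial.eval_X, hc] at this
  rw [← this]
  exact Finset.sum_congr rfl fun j _ => by ring

/-- A combination of binomial moments, for the quadratic vanishing at `k` and `k + 1`. -/
lemma sum_bernstein_mul_sub_mul_sub (n k : ℕ) (hn : 0 < n) {t f : ℝ} (ht : (n : ℝ) * t = k + f) :
    ∑ j ∈ Finset.range (n + 1), (n.choose j : ℝ) * t ^ j * (1 - t) ^ (n - j) *
      (((j : ℝ) - k) * (j - k - 1)) = f ^ 2 + k - (k + f) ^ 2 / n := by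
  have hn' : (n : ℝ) ≠ 0 := by positivity
  have h : ∀ j : ℕ, (n.choose j : ℝ) * t ^ j * (1 - t) ^ (n - j) * (((j : ℝ) - k) * (j - k - 1)) =
      (n.choose j : ℝ) * t ^ j * (1 - t) ^ (n - j) * ((j : ℝ) * (j - 1)) -
      2 * k * ((n.choose j : ℝ) * t ^ j * (1 - t) ^ (n - j) * j) +
      (k ^ 2 + k) * ((n.choose j : ℝ) * t ^ j * (1 - t) ^ (n - j)) := fun j => by ring
  simp only [h]
  rw [Finset.sum_add_distrib, Finset.sum_sub_distrib, ← Finset.mul_sum, ← Finset.mul_sum,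
    sum_bernstein, sum_bernstein_mul, sum_bernstein_mul_mul]
  have ht' : t = (k + f) / n := by rw [← ht]; field_simp
  rw [ht']
  field_simp
  ring

/-- A convex sequence lies above its secant lines of consecutive points. -/
lemma secant_le_of_convex {n k j : ℕ} {b : ℕ → ℝ}
    (hb : ∀ j, j + 2 ≤ n → b (j + 1) - b j ≤ b (j + 2) - b (j + 1)) (hk : k < n) (hj : j ≤ n) :
    b k + ((j : ℝ) - k) * (b (k + 1) - b k) ≤ b j := by
  have hmono : ∀ i l : ℕ, i ≤ l → l < n → b (i + 1) - b i ≤ b (l + 1) - b l := by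
    intro i l hil
    induction l, hil using Nat.le_induction with
    | base => intro _; exact le_rfl
    | succ l _ ih => intro hl; exact (ih (by omega)).trans (hb l (by omega))
  rcases le_total k j with hkj | hkj
  · induction j, hkj using Nat.le_induction with
    | base => simp
    | succ l hkl ih =>
      have := hmono k l hkl (by omega)
      have := ih (by omega)
      push_cast
      linarith
  · induction k, hkj using Nat.le_induction with
    | base => simp
    | succ l hjl ih =>
      have h1 := hmono l (l + 1) (by omega) (by omega)
      have h2 := ih (by omega)
      have h3 : (j : ℝ) ≤ l := by exact_mod_cast hjl
      push_cast
      nlinarith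

/-- Adding `D / 2 * j ^ 2` makes both `b` and `-b` convex. The quadratic exceeds its own secant by
exactly the right-hand side. -/
lemma abs_sub_secant_le {n k j : ℕ} {b : ℕ → ℝ} {D : ℝ}
    (hb : ∀ j, j + 2 ≤ n → |b (j + 2) - 2 * b (j + 1) + b j| ≤ D) (hk : k < n) (hj : j ≤ n) :
    |b j - (b k + ((j : ℝ) - k) * (b (k + 1) - b k))| ≤
      D / 2 * (((j : ℝ) - k) * (j - k - 1)) := by
  have h1 := secant_le_of_convex (b := fun j => D / 2 * (j : ℝ) ^ 2 + b j)
    (fun j hj => by have := abs_le.1 (hb j hj); push_cast; nlinarith) hk hj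
  have h2 := secant_le_of_convex (b := fun j => D / 2 * (j : ℝ) ^ 2 - b j)
    (fun j hj => by have := abs_le.1 (hb j hj); push_cast; nlinarith) hk hj
  push_cast at h1 h2
  rw [abs_le]
  constructor <;> nlinarith

lemma nInfty_eq (n : ℕ) : NInfty n = ((n / 2 * ((n + 1) / 2) : ℕ) : ℝ) / (2 * n) := by
  have h1 : ⌊(n : ℝ) / 2⌋ = ((n / 2 : ℕ) : ℤ) := by
    rw [Int.floor_eq_iff]
    rcases Nat.even_or_odd' n with ⟨q, rfl | rfl⟩
    · rw [show 2 * q / 2 = q by omega]; push_cast; constructor <;> linarith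
    · rw [show (2 * q + 1) / 2 = q by omega]; push_cast; constructor <;> linarith
  have h2 : ⌈(n : ℝ) / 2⌉ = (((n + 1) / 2 : ℕ) : ℤ) := by
    rw [Int.ceil_eq_iff]
    rcases Nat.even_or_odd' n with ⟨q, rfl | rfl⟩
    · rw [show (2 * q + 1) / 2 = q by omega]; push_cast; constructor <;> linarith
    · rw [show (2 * q + 1 + 1) / 2 = q + 1 by omega]; push_cast; constructor <;> linarith
  rw [NInfty, h1, h2]
  push_cast
  rfl

lemma nInfty_nonneg (n : ℕ) : 0 ≤ NInfty n := by rw [nInfty_eq]; positivity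

/-- Over the integers, `k (n - k)` is largest next to `n / 2`; in `key`, `n = 2 q + e` with `e` the
parity. -/
lemma mul_sub_le_floor_mul_ceil (n k : ℕ) :
    (k : ℝ) * (n - k) ≤ ((n / 2 * ((n + 1) / 2) : ℕ) : ℝ) := by
  have key : ∀ q e z : ℤ, (e = 0 ∨ e = 1) → z * (2 * q + e - z) ≤ q * (q + e) := by
    rintro q e z (rfl | rfl)
    · nlinarith [sq_nonneg (z - q)]
    · rcases le_or_gt z q with h | h
      · nlinarith
      · nlinarith
  have h := key (n / 2 : ℕ) (n % 2 : ℕ) k (by omega)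
  have h1 : (2 * ((n / 2 : ℕ) : ℤ) + (n % 2 : ℕ)) = n := by omega
  have h2 : (((n / 2 : ℕ) : ℤ) + (n % 2 : ℕ)) = ((n + 1) / 2 : ℕ) := by omega
  rw [h1, h2] at h
  generalize n / 2 = x at h ⊢
  generalize (n + 1) / 2 = y at h ⊢
  have h' := (Int.cast_le (R := ℝ)).2 h
  push_cast at h' ⊢
  exact h'

/-- The secant through `k` and `k + 1` is its own Bernstein average, so the error is an average of
deviations from this secant. -/
lemma abs_sum_bernstein_sub_le {n k : ℕ} {b : ℕ → ℝ} {D t f : ℝ}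
    (hb : ∀ j, j + 2 ≤ n → |b (j + 2) - 2 * b (j + 1) + b j| ≤ D) (hD : 0 ≤ D) (hk : k < n)
    (ht : t ∈ Icc (0 : ℝ) 1) (hf : f ∈ Icc (0 : ℝ) 1) (hkf : (n : ℝ) * t = k + f) :
    |∑ j ∈ Finset.range (n + 1), (n.choose j : ℝ) * t ^ j * (1 - t) ^ (n - j) * b j -
      (b k + f * (b (k + 1) - b k))| ≤ NInfty n * D := by
  have hn : 0 < n := by omega
  have hn' : (0 : ℝ) < n := by exact_mod_cast hn
  have hn1 : (1 : ℝ) ≤ n := by exact_mod_cast hn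
  have hlin : ∑ j ∈ Finset.range (n + 1), (n.choose j : ℝ) * t ^ j * (1 - t) ^ (n - j) *
      (b k + ((j : ℝ) - k) * (b (k + 1) - b k)) = b k + f * (b (k + 1) - b k) := by
    have h : ∀ j : ℕ, (n.choose j : ℝ) * t ^ j * (1 - t) ^ (n - j) *
        (b k + ((j : ℝ) - k) * (b (k + 1) - b k)) =
        (b k - k * (b (k + 1) - b k)) * ((n.choose j : ℝ) * t ^ j * (1 - t) ^ (n - j)) +
        (b (k + 1) - b k) * ((n.choose j : ℝ) * t ^ j * (1 - t) ^ (n - j) * j) :=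
      fun j => by ring
    simp only [h]
    rw [Finset.sum_add_distrib, ← Finset.mul_sum, ← Finset.mul_sum, sum_bernstein,
      sum_bernstein_mul, hkf]
    ring
  rw [← hlin, ← Finset.sum_sub_distrib]
  have hw : ∀ j, 0 ≤ (n.choose j : ℝ) * t ^ j * (1 - t) ^ (n - j) := fun j =>
    mul_nonneg (mul_nonneg (Nat.cast_nonneg _) (pow_nonneg ht.1 _))
      (pow_nonneg (by linarith [ht.2]) _)
  refine (Finset.abs_sum_le_sum_abs _ _).trans ?_
  have hle : ∀ j ∈ Finset.range (n + 1),
      |(n.choose j : ℝ) * t ^ j * (1 - t) ^ (n - j) * b j -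
        (n.choose j : ℝ) * t ^ j * (1 - t) ^ (n - j) *
          (b k + ((j : ℝ) - k) * (b (k + 1) - b k))| ≤
      D / 2 * ((n.choose j : ℝ) * t ^ j * (1 - t) ^ (n - j) * (((j : ℝ) - k) * (j - k - 1))) := by
    intro j hj
    rw [← mul_sub, abs_mul, abs_of_nonneg (hw j), mul_left_comm]
    exact mul_le_mul_of_nonneg_left
      (abs_sub_secant_le hb hk (by simpa [Nat.lt_succ_iff] using hj)) (hw j)
  refine (Finset.sum_le_sum hle).trans ?_
  rw [← Finset.mul_sum, sum_bernstein_mul_sub_mul_sub n k hn hkf, nInfty_eq]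
  have h0 := mul_sub_le_floor_mul_ceil n k
  have h1 := mul_sub_le_floor_mul_ceil n (k + 1)
  set Q : ℝ := ((n / 2 * ((n + 1) / 2) : ℕ) : ℝ)
  push_cast at h1
  -- The left side is `(1 - f) k (n - k) + f (k + 1) (n - k - 1) - (n - 1) f (1 - f)`.
  have h2 : (n : ℝ) * f ^ 2 + n * k - (k + f) ^ 2 ≤ Q := by
    have h3 := mul_le_mul_of_nonneg_left h0 (sub_nonneg.2 hf.2)
    have h4 := mul_le_mul_of_nonneg_left h1 hf.1
    have h5 : 0 ≤ ((n : ℝ) - 1) * (f * (1 - f)) :=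
      mul_nonneg (by linarith) (mul_nonneg hf.1 (by linarith [hf.2]))
    linarith
  have h6 : f ^ 2 + k - (k + f) ^ 2 / n = ((n : ℝ) * f ^ 2 + n * k - (k + f) ^ 2) / n := by
    field_simp
  rw [h6]
  calc D / 2 * (((n : ℝ) * f ^ 2 + n * k - (k + f) ^ 2) / n) ≤ D / 2 * (Q / n) := by gcongr
    _ = Q / (2 * n) * D := by field_simp

lemma norm_le_norm_of_abs_le {x y : Space3} (h : ∀ c, |x c| ≤ y c) : ‖x‖ ≤ ‖y‖ := by
  rw [EuclideanSpace.norm_eq, EuclideanSpace.norm_eq]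
  gcongr with c
  exact (h c).trans (le_abs_self _)

/-- The distance between a Bézier curve and its control polygon, in terms of bounds `D` for the
coordinates of the second differences of the control points. -/
lemma dist_bezier_polyline_le {n : ℕ} (hn : 0 < n) (q : ℕ → Space3) (D : Space3)
    (hD : ∀ c, 0 ≤ D c) (h : ∀ c, ∀ j, j + 2 ≤ n → |(fwdDiff 1)^[2] q j c| ≤ D c) {t : ℝ}
    (ht : t ∈ Icc (0 : ℝ) 1) : dist (bezier n q t) (polyline n q t) ≤ NInfty n * ‖D‖ := by
  obtain ⟨k, hk, f, hf, hkf, -⟩ := exists_eq_add_of_mem_Icc hn ht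
  rw [polyline_apply q k hf hkf, dist_eq_norm]
  have h1 : ‖NInfty n • D‖ = NInfty n * ‖D‖ := by
    rw [norm_smul, Real.norm_of_nonneg (nInfty_nonneg n)]
  rw [← h1]
  refine norm_le_norm_of_abs_le fun c => ?_
  have h2 := abs_sum_bernstein_sub_le (b := fun j => q j c) (D := D c)
    (fun j hj => by
      refine le_trans (le_of_eq ?_) (h c j hj)
      congr 1
      simp [fwdDiff]
      ring) (hD c) hk ht hf hkf
  refine le_trans (le_of_eq ?_) h2
  congr 1
  simp [bezier, AffineMap.lineMap_apply]
  ring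

/-! ### Pipe sections and simplicity of the control polygon -/

lemma IsPartition.monotone {m : ℕ} {a : ℕ → ℝ} (ha : IsPartition m a) {k l : ℕ} (hkl : k ≤ l)
    (hl : l ≤ m) : a k ≤ a l := by
  induction l, hkl using Nat.le_induction with
  | base => exact le_rfl
  | succ l _ ih => exact (ih (by omega)).trans (ha.lt l (by omega)).le

lemma IsPartition.pos {m : ℕ} {a : ℕ → ℝ} (ha : IsPartition m a) : 0 < m := by
  rcases Nat.eq_zero_or_pos m with h | h
  · have h1 := ha.last
    rw [h, ha.first] at h1
    exact absurd h1 zero_ne_one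
  · exact h

lemma IsPartition.mem_Icc {m : ℕ} {a : ℕ → ℝ} (ha : IsPartition m a) {k : ℕ} (hk : k < m) {s : ℝ}
    (hs : s ∈ Icc (0 : ℝ) 1) : a k + s * (a (k + 1) - a k) ∈ Icc (0 : ℝ) 1 := by
  have h0 := ha.monotone (Nat.zero_le k) hk.le
  have h1 := ha.monotone (show k + 1 ≤ m from hk) le_rfl
  have h2 := ha.lt k hk
  rw [ha.first] at h0
  rw [ha.last] at h1
  constructor
  · nlinarith [hs.1]
  · nlinarith [hs.2]

lemma IsCompositeBezier.smul_velocity {n m : ℕ} {a : ℕ → ℝ} {P : ℕ → ℕ → Space3} {γ : ℝ → Space3}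
    (h : IsCompositeBezier (n + 1) m a P γ) (ha : IsPartition m a)
    (hγ : DifferentiableOn ℝ γ (Icc 0 1)) {k : ℕ} (hk : k < m) {s : ℝ} (hs : s ∈ Icc (0 : ℝ) 1) :
    (a (k + 1) - a k) • velocity γ (a k + s * (a (k + 1) - a k)) =
      ((n : ℝ) + 1) • bezier n (fwdDiff 1 (P k)) s := by
  have h1 : HasDerivWithinAt γ (velocity γ (a k + s * (a (k + 1) - a k))) (Icc 0 1)
      (a k + s * (a (k + 1) - a k)) := (hγ _ (ha.mem_Icc hk hs)).hasDerivWithinAt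
  have h2 : HasDerivWithinAt (fun s : ℝ => a k + s * (a (k + 1) - a k)) (a (k + 1) - a k)
      (Icc 0 1) s := by
    simpa using (((hasDerivAt_id s).mul_const (a (k + 1) - a k)).const_add
      (a k)).hasDerivWithinAt (s := Icc (0 : ℝ) 1)
  have h3 := HasDerivWithinAt.scomp s h1 h2 fun x hx => ha.mem_Icc hk hx
  have h4 := (hasDerivAt_bezier n (P k) s).hasDerivWithinAt (s := Icc (0 : ℝ) 1)
  have h5 := h4.congr (f₁ := γ ∘ fun s : ℝ => a k + s * (a (k + 1) - a k))
    (fun x hx => h k hk x hx) (h k hk s hs)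
  exact (uniqueDiffOn_Icc zero_lt_one s hs).eq_deriv _ h3 h5

/-- The first-order condition at a point of a curve on `[0, 1]` that is nearest to `x`. -/
lemma inner_sub_mul_le_of_nearest {B : ℝ → Space3} {B' x : Space3} {u : ℝ}
    (hu : u ∈ Icc (0 : ℝ) 1) (hB : HasDerivAt B B' u)
    (hmin : ∀ y ∈ Icc (0 : ℝ) 1, dist x (B u) ≤ dist x (B y)) {y : ℝ} (hy : y ∈ Icc (0 : ℝ) 1) :
    (y - u) * inner ℝ (x - B u) B' ≤ 0 := by
  have h1 : HasDerivAt (fun t => ‖B t - x‖ ^ 2) (2 * inner ℝ (B u - x) B') u :=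
    (hB.sub_const x).norm_sq
  have h2 : IsMinOn (fun t => ‖B t - x‖ ^ 2) (Icc 0 1) u := fun y hy => by
    have := hmin y hy
    rw [dist_comm, dist_comm x, dist_eq_norm, dist_eq_norm] at this
    simp only [mem_ofPred_eq]
    gcongr
  have h3 := h2.localize.hasFDerivWithinAt_nonneg h1.hasFDerivAt.hasFDerivWithinAt
    (sub_mem_posTangentConeAt_of_segment_subset ((convex_Icc 0 1).segment_subset hu hy))
  simp only [ContinuousLinearMap.toSpanSingleton_apply, smul_eq_mul] at h3
  have h4 : inner ℝ (x - B u) B' = -inner ℝ (B u - x) B' := by rw [← inner_neg_left, neg_sub]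
  rw [h4]
  linarith

lemma polyline_zero {N : ℕ} (v : ℕ → Space3) : polyline N v 0 = v 0 := by
  rw [polyline_apply v 0 (f := 0) (by simp) (by simp)]
  simp

lemma polyline_one {N : ℕ} (v : ℕ → Space3) : polyline N v 1 = v N := by
  rw [polyline_apply v N (f := 0) (by simp) (by simp)]
  simp

/-- A control polygon whose edges are pairwise at acute angles lies in the pipe section of its
curve segment, and inside that section except for its end points. -/
lemma IsCompositeBezier.exists_mem_normalDisc {n m : ℕ} {a : ℕ → ℝ} {P : ℕ → ℕ → Space3}
    {γ : ℝ → Space3} {r : ℝ} (h : IsCompositeBezier (n + 1) m a P γ) (ha : IsPartition m a)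
    (hγ : DifferentiableOn ℝ γ (Icc 0 1)) {k : ℕ} (hk : k < m)
    (hacute : ∀ i < n + 1, ∀ j < n + 1,
      0 < inner ℝ (P k (i + 1) - P k i) (P k (j + 1) - P k j))
    (hdist : ∀ t ∈ Icc (0 : ℝ) 1,
      dist (bezier (n + 1) (P k) t) (polyline (n + 1) (P k) t) ≤ r)
    {u : ℝ} (hu : u ∈ Icc (0 : ℝ) 1) :
    ∃ s ∈ Icc (0 : ℝ) 1,
      polyline (n + 1) (P k) u ∈ normalDisc γ r (a k + s * (a (k + 1) - a k)) ∧
        (s = 0 → u = 0) ∧ (s = 1 → u = 1) := by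
  set x := polyline (n + 1) (P k) u with hx
  have hcont : Continuous (bezier (n + 1) (P k)) :=
    continuous_iff_continuousAt.2 fun t => (hasDerivAt_bezier n (P k) t).continuousAt
  obtain ⟨s, hs, hmin⟩ := isCompact_Icc.exists_isMinOn (nonempty_Icc.2 zero_le_one)
    (continuous_const.dist hcont : Continuous fun t => dist x (bezier (n + 1) (P k) t)).continuousOn
  have hfoc : ∀ y ∈ Icc (0 : ℝ) 1, (y - s) * inner ℝ (x - bezier (n + 1) (P k) s)
      (bezier n (fwdDiff 1 (P k)) s) ≤ 0 := fun y hy => by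
    have := inner_sub_mul_le_of_nearest hs (hasDerivAt_bezier n (P k) s) hmin hy
    rw [real_inner_smul_right, mul_left_comm] at this
    exact nonpos_of_mul_nonpos_right this (by positivity)
  -- At the end `s = 0` the first-order condition gives `x` a nonpositive component along the first
  -- edge, against strict advance unless `u = 0`.
  have h0 : s = 0 → u = 0 := by
    rintro rfl
    by_contra hne
    have h1 := inner_polyline_lt n.succ_pos (P k) (P k 1 - P k 0)
      (fun j hj => hacute j hj 0 n.succ_pos) ⟨le_rfl, zero_le_one⟩ hu
      (lt_of_le_of_ne hu.1 (Ne.symm hne))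
    have h2 := hfoc 1 (by simp)
    rw [bezier_zero, bezier_zero, inner_sub_left] at h2
    rw [polyline_zero] at h1
    simp only [fwdDiff, zero_add] at h2
    linarith
  have h1 : s = 1 → u = 1 := by
    rintro rfl
    by_contra hne
    have h1 := inner_polyline_lt n.succ_pos (P k) (P k (n + 1) - P k n)
      (fun j hj => hacute j hj n n.lt_succ_self) hu ⟨zero_le_one, le_rfl⟩ (lt_of_le_of_ne hu.2 hne)
    have h2 := hfoc 0 (by simp)
    rw [bezier_one, bezier_one, inner_sub_left] at h2
    rw [polyline_one] at h1
    simp only [fwdDiff] at h2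
    linarith
  -- In the interior, testing with `y = 0` and `y = 1` gives both signs; at the ends `x` is the
  -- curve point itself.
  have horth : inner ℝ (x - bezier (n + 1) (P k) s) (bezier n (fwdDiff 1 (P k)) s) = 0 := by
    rcases hs.1.eq_or_lt with hs0 | hs0
    · have hu0 := h0 hs0.symm
      rw [hx, hu0, ← hs0, polyline_zero, bezier_zero, sub_self, inner_zero_left]
    rcases hs.2.eq_or_lt with hs1 | hs1
    · have hu1 := h1 hs1
      rw [hx, hu1, hs1, polyline_one, bezier_one, sub_self, inner_zero_left]
    have ha := hfoc 0 (by simp)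
    have hb := hfoc 1 (by simp)
    nlinarith
  refine ⟨s, hs, ⟨?_, ?_⟩, h0, h1⟩
  · have hv := h.smul_velocity ha hγ hk hs
    have hpos := sub_pos.2 (ha.lt k hk)
    have : (a (k + 1) - a k) * inner ℝ (x - γ (a k + s * (a (k + 1) - a k)))
        (velocity γ (a k + s * (a (k + 1) - a k))) = 0 := by
      rw [← real_inner_smul_right, hv, real_inner_smul_right, h k hk s hs, horth, mul_zero]
    exact (mul_eq_zero.1 this).resolve_left hpos.ne'
  · rw [h k hk s hs]
    -- The nearest point is no farther than the curve point at the polygon's own parameter `u`.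
    have h2 : dist x (bezier (n + 1) (P k) s) ≤ dist x (bezier (n + 1) (P k) u) := hmin hu
    rw [dist_comm x (bezier _ _ u)] at h2
    exact h2.trans (hdist u hu)

lemma IsCompositeBezier.joint {n m : ℕ} {a : ℕ → ℝ} {P : ℕ → ℕ → Space3} {γ : ℝ → Space3}
    (h : IsCompositeBezier n m a P γ) {k : ℕ} (hk : k + 1 < m) : P k n = P (k + 1) 0 := by
  have h1 := h k (by omega) 1 (by simp)
  have h2 := h (k + 1) hk 0 (by simp)
  rw [bezier_one, one_mul, add_sub_cancel] at h1
  rw [bezier_zero, zero_mul, add_zero] at h2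
  rw [← h1, h2]

lemma IsCompositeBezier.vertices_apply {n m : ℕ} {a : ℕ → ℝ} {P : ℕ → ℕ → Space3} {γ : ℝ → Space3}
    (h : IsCompositeBezier n m a P γ) (hn : 0 < n) {k j : ℕ} (hk : k < m) (hj : j ≤ n) :
    vertices n m P (n * k + j) = P k j := by
  unfold vertices
  rcases hj.lt_or_eq with hj | rfl
  · have : n * k + j < n * m := by
      have := Nat.mul_le_mul_left n (show k + 1 ≤ m from hk)
      rw [mul_add] at this
      omega
    rw [if_pos this, Nat.mul_add_div hn, Nat.mul_add_mod, Nat.div_eq_of_lt hj,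
      Nat.mod_eq_of_lt hj, add_zero]
  · rw [← Nat.mul_succ]
    rcases (show k + 1 ≤ m from hk).lt_or_eq with hk' | rfl
    · rw [if_pos (Nat.mul_lt_mul_of_pos_left hk' hn), Nat.mul_div_cancel_left _ hn,
        Nat.mul_mod_right, h.joint hk']
    · rw [if_neg (lt_irrefl _), Nat.add_sub_cancel]

lemma IsCompositeBezier.polyline_vertices {n m : ℕ} {a : ℕ → ℝ} {P : ℕ → ℕ → Space3}
    {γ : ℝ → Space3} (h : IsCompositeBezier n m a P γ) (hn : 0 < n) {k : ℕ} (hk : k < m) {t u : ℝ}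
    (hu : u ∈ Icc (0 : ℝ) 1) (ht : (m : ℝ) * t = k + u) :
    polyline (n * m) (vertices n m P) t = polyline n (P k) u := by
  obtain ⟨j, hj, f, hf, hjf, -⟩ := exists_eq_add_of_mem_Icc hn hu
  rw [polyline_apply (P k) j hf hjf, polyline_apply _ (n * k + j) hf, h.vertices_apply hn hk hj.le,
    add_assoc, h.vertices_apply hn hk hj]
  push_cast
  rw [mul_assoc, ht, mul_add, hjf]
  ring

/-- If the edges of the control polygon of each segment are pairwise at acute angles, and each
control polygon is within the radius of a non-self-intersecting pipe of its curve segment, then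
the whole control polygon is simple. -/
lemma IsCompositeBezier.isSimpleCurve_polyline {n m : ℕ} {a : ℕ → ℝ} {P : ℕ → ℕ → Space3}
    {γ : ℝ → Space3} {r : ℝ} (h : IsCompositeBezier (n + 1) m a P γ) (ha : IsPartition m a)
    (hγ : DifferentiableOn ℝ γ (Icc 0 1)) (hpipe : PipeNonSelfIntersecting γ r)
    (hacute : ∀ k < m, ∀ i < n + 1, ∀ j < n + 1,
      0 < inner ℝ (P k (i + 1) - P k i) (P k (j + 1) - P k j))
    (hdist : ∀ k < m, ∀ t ∈ Icc (0 : ℝ) 1,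
      dist (bezier (n + 1) (P k) t) (polyline (n + 1) (P k) t) ≤ r) :
    IsSimpleCurve (polyline ((n + 1) * m) (vertices (n + 1) m P)) := by
  intro s hs t ht hst heq
  have hm := ha.pos
  have hm' : (0 : ℝ) < m := by exact_mod_cast hm
  obtain ⟨k, hk, u, hu, hku, hu1⟩ := exists_eq_add_of_mem_Icc hm hs
  obtain ⟨l, hl, w, hw, hlw, -⟩ := exists_eq_add_of_mem_Icc hm ht
  have hlt : (k : ℝ) + u < l + w := by rw [← hku, ← hlw]; exact mul_lt_mul_of_pos_left hst hm'
  rw [h.polyline_vertices n.succ_pos hk hu hku, h.polyline_vertices n.succ_pos hl hw hlw] at heq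
  rcases lt_trichotomy k l with hkl | rfl | hkl
  · obtain ⟨u', hu', hdu, hu0', hu1'⟩ :=
      h.exists_mem_normalDisc ha hγ hk (hacute k hk) (hdist k hk) hu
    obtain ⟨w', hw', hdw, hw0', hw1'⟩ :=
      h.exists_mem_normalDisc ha hγ hl (hacute l hl) (hdist l hl) hw
    have hak := ha.lt k hk
    have hal := ha.lt l hl
    have hmono := ha.monotone (show k + 1 ≤ l from hkl) hl.le
    -- A value `u' = 1` would force `k` to be the last segment. Hence the disc parameters are
    -- distinct even for adjacent segments.
    have hu'1 : u' < 1 := lt_of_le_of_ne hu'.2 fun h1 => by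
      have := hu1 (hu1' h1)
      omega
    have h1 : a k + u' * (a (k + 1) - a k) < a l + w' * (a (l + 1) - a l) := by
      have := mul_nonneg hw'.1 (sub_pos.2 hal).le
      nlinarith
    rcases hpipe _ (ha.mem_Icc hk hu') _ (ha.mem_Icc hl hw') h1 with hdisj | ⟨h0, ht1, -⟩
    -- In the remaining case the discs sit at `0` and `1`, so the polygon points are the ends of the
    -- first and last segments.
    · exact absurd (heq ▸ hdw) (disjoint_left.1 hdisj hdu)
    · have hk0 : k = 0 := by
        by_contra hk0
        have h2 := ha.monotone (show 1 ≤ k by omega) hk.le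
        have h3 := ha.lt 0 hm
        rw [ha.first] at h3
        have := mul_nonneg hu'.1 (sub_pos.2 hak).le
        rw [zero_add] at h3
        linarith
      have hlm : l + 1 = m := by
        by_contra hlm
        have h2 := ha.lt (l + 1) (by omega)
        have h3 := ha.monotone (show l + 1 + 1 ≤ m by omega) le_rfl
        rw [ha.last] at h3
        have := mul_le_mul_of_nonneg_right hw'.2 (sub_pos.2 hal).le
        linarith
      subst hk0
      rw [ha.first, zero_add, mul_eq_zero] at h0
      have hu0 := hu0' (h0.resolve_right (by rw [ha.first] at hak; linarith))
      have ham : a (l + 1) = 1 := by rw [hlm, ha.last]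
      have hw1 := hw1' (by
        rw [ham] at ht1 hal
        have : (1 - w') * (1 - a l) = 0 := by linarith
        rcases mul_eq_zero.1 this with h | h <;> linarith)
      constructor
      · rw [hu0, Nat.cast_zero, add_zero, mul_eq_zero] at hku
        exact hku.resolve_left hm'.ne'
      · rw [hw1] at hlw
        have h2 : (m : ℝ) = l + 1 := by rw [← hlm]; push_cast; rfl
        rw [← h2] at hlw
        exact mul_left_cancel₀ hm'.ne' (by rw [hlw, mul_one])
  · have := inner_polyline_lt n.succ_pos (P k) (P k 1 - P k 0)
      (fun j hj => hacute k hk j hj 0 n.succ_pos) hu hw (by linarith)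
    rw [heq] at this
    exact absurd this (lt_irrefl _)
  · have : (l : ℝ) + 1 ≤ k := by exact_mod_cast hkl
    linarith [hu.1, hw.2]

/-! ### Images as quotients of the parameter interval -/

lemma isQuotientMap_imageFactorization {X : Type*} [TopologicalSpace X] [T2Space X] {K : Set ℝ}
    (hK : IsCompact K) {f : ℝ → X} (hf : ContinuousOn f K) :
    Topology.IsQuotientMap (K.imageFactorization f) := by
  have : CompactSpace K := isCompact_iff_compactSpace.1 hK
  have hc : Continuous (K.imageFactorization f) :=
    (continuousOn_iff_continuous_domRestrict.1 hf).subtype_mk _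
  exact hc.isClosedMap.isQuotientMap hc imageFactorization_surjective

/-- Two curves with the same self-intersections parametrize homeomorphic sets. -/
lemma nonempty_homeomorph_image {X Y : Type*} [TopologicalSpace X] [TopologicalSpace Y] [T2Space X]
    [T2Space Y] {K : Set ℝ} (hK : IsCompact K) {f : ℝ → X} {g : ℝ → Y} (hf : ContinuousOn f K)
    (hg : ContinuousOn g K) (h : ∀ s ∈ K, ∀ t ∈ K, f s = f t ↔ g s = g t) :
    Nonempty ((f '' K) ≃ₜ (g '' K)) := by
  have hF := isQuotientMap_imageFactorization hK hf
  have hG := isQuotientMap_imageFactorization hK hg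
  let F : C(K, f '' K) := ⟨_, hF.continuous⟩
  let G : C(K, g '' K) := ⟨_, hG.continuous⟩
  -- Both images are the quotient of `K` by this one equivalence relation.
  have hker : Setoid.ker F = Setoid.ker G := by
    ext s t
    simpa [Setoid.ker_def, F, G, imageFactorization, Subtype.ext_iff] using h s s.2 t t.2
  have e₁ := Topology.IsQuotientMap.homeomorph (f := F) hF
  have e₂ := Topology.IsQuotientMap.homeomorph (f := G) hG
  rw [hker] at e₁
  exact ⟨e₁.symm.trans e₂⟩

/-! ### Turning angles of the edges -/

/-- By the law of cosines, an angle of at least `ν` would give `‖u - v‖ ^ 2 ≥ 2 (1 - cos ν) s ^ 2`,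
more than the assumed bound allows. -/
lemma angle_lt_of_norm_sub_le {u v : Space3} {s ν : ℝ} (hs : 0 < s) (hν : 0 < ν) (hν' : ν ≤ Real.pi / 2)
    (hu : s ≤ ‖u‖) (hv : s ≤ ‖v‖) (huv : ‖u - v‖ ≤ (1 - Real.cos ν) * s / 2) :
    InnerProductGeometry.angle u v < ν := by
  by_contra! hle
  have hcos := Real.cos_le_cos_of_nonneg_of_le_pi hν.le (InnerProductGeometry.angle_le_pi u v) hle
  have hc0 : 0 ≤ Real.cos ν := Real.cos_nonneg_of_mem_Icc ⟨by linarith, hν'⟩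
  have hc1 : Real.cos ν < 1 := by
    have := Real.cos_lt_cos_of_nonneg_of_le_pi_div_two le_rfl hν' hν
    rwa [Real.cos_zero] at this
  have h1 := norm_sub_sq_real u v
  rw [← InnerProductGeometry.cos_angle_mul_norm_mul_norm u v] at h1
  have h2 : s * s ≤ ‖u‖ * ‖v‖ := mul_le_mul hu hv hs.le (norm_nonneg _)
  have h3 : Real.cos (InnerProductGeometry.angle u v) * (‖u‖ * ‖v‖) ≤
      Real.cos ν * (‖u‖ * ‖v‖) := mul_le_mul_of_nonneg_right hcos (by positivity)
  have h4 : 2 * (1 - Real.cos ν) * (s * s) ≤ ‖u - v‖ ^ 2 := by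
    have := mul_le_mul_of_nonneg_left h2 (sub_pos.2 hc1).le
    nlinarith [sq_nonneg (‖u‖ - ‖v‖)]
  have h5 : ‖u - v‖ ^ 2 ≤ ((1 - Real.cos ν) * s / 2) ^ 2 := by gcongr
  have h6 : 0 < (1 - Real.cos ν) * (s * s) := mul_pos (sub_pos.2 hc1) (mul_pos hs hs)
  nlinarith [mul_nonneg hc0 h6.le]

lemma angle_lt_mul_of_consecutive {n : ℕ} {e : ℕ → Space3} {ν : ℝ}
    (h : ∀ j < n, InnerProductGeometry.angle (e j) (e (j + 1)) < ν) (i l : ℕ) (hl : i + l < n) :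
    InnerProductGeometry.angle (e i) (e (i + l + 1)) < (l + 1) * ν := by
  induction l with
  | zero => simpa using h i hl
  | succ l ih =>
    have h1 := ih (by omega)
    have h2 := h (i + l + 1) (by omega)
    have h3 := InnerProductGeometry.angle_le_angle_add_angle (e i) (e (i + l + 1))
      (e (i + l + 1 + 1))
    push_cast
    rw [← add_assoc]
    linarith

/-- Consecutive vectors whose turning angles add up to less than `π / 2` are pairwise at acute
angles. -/
lemma inner_pos_of_consecutive {n : ℕ} (hn : 0 < n) {e : ℕ → Space3} (he : ∀ j ≤ n, e j ≠ 0)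
    (h : ∀ j < n, InnerProductGeometry.angle (e j) (e (j + 1)) < Real.pi / (2 * n)) {i j : ℕ}
    (hi : i ≤ n) (hj : j ≤ n) : 0 < inner ℝ (e i) (e j) := by
  wlog hij : i ≤ j generalizing i j
  · rw [real_inner_comm]
    exact this hj hi (le_of_not_ge hij)
  rcases hij.eq_or_lt with rfl | hij
  · exact real_inner_self_pos.2 (he i hi)
  obtain ⟨l, rfl⟩ := Nat.exists_eq_add_of_lt hij
  have h1 := angle_lt_mul_of_consecutive h i l (by omega)
  have hn' : (0 : ℝ) < n := by exact_mod_cast hn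
  have h2 : ((l : ℝ) + 1) * (Real.pi / (2 * n)) ≤ Real.pi / 2 := by
    have : (l : ℝ) + 1 ≤ n := by exact_mod_cast (show l + 1 ≤ n by omega)
    calc ((l : ℝ) + 1) * (Real.pi / (2 * n)) ≤ n * (Real.pi / (2 * n)) := by
          have := Real.pi_pos
          gcongr
      _ = Real.pi / 2 := by field_simp
  rw [← InnerProductGeometry.cos_angle_mul_norm_mul_norm]
  refine mul_pos (Real.cos_pos_of_mem_Ioo ⟨?_, by linarith⟩)
    (mul_pos (norm_pos_iff.2 (he _ hi)) (norm_pos_iff.2 (he _ hj)))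
  have := InnerProductGeometry.angle_nonneg (e i) (e (i + l + 1))
  linarith [Real.pi_pos]

/-! ### Estimates after `i` subdivisions -/

/-- The absolute value of a coordinate. -/
noncomputable def coordSeminorm (c : Fin 3) : Seminorm ℝ Space3 :=
  (normSeminorm ℝ ℝ).comp (EuclideanSpace.proj c : Space3 →L[ℝ] ℝ).toLinearMap

lemma coordSeminorm_apply (c : Fin 3) (x : Space3) : coordSeminorm c x = |x c| := rfl

lemma secondDifference_nonneg (d m : ℕ) (P : ℕ → ℕ → Space3) (c : Fin 3) :
    0 ≤ secondDifference d m P c :=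
  Real.iSup_nonneg fun _ => abs_nonneg _

lemma coordSeminorm_fwdDiff_le {d m : ℕ} (P : ℕ → ℕ → Space3) (c : Fin 3) {k j : ℕ} (hk : k < m)
    (hj : j + 2 ≤ d) : coordSeminorm c ((fwdDiff 1)^[2] (P k) j) ≤ secondDifference d m P c := by
  refine le_trans (le_of_eq ?_) (le_ciSup (f := fun q : Fin m × Fin (d - 1) =>
    |P q.1 q.2 c - 2 * P q.1 (q.2 + 1) c + P q.1 (q.2 + 2) c|)
    (Set.finite_range _).bddAbove (⟨k, hk⟩, ⟨j, by omega⟩))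
  rw [coordSeminorm_apply]
  congr 1
  simp [fwdDiff]
  ring

lemma dist_bezier_polyline_le_of_fwdDiff_le {n : ℕ} (hn : 0 < n) {q : ℕ → Space3} {D : Space3}
    {ε : ℝ} (hε : 0 ≤ ε) (hD : ∀ c, 0 ≤ D c)
    (h : ∀ c, ∀ j, j + 2 ≤ n → coordSeminorm c ((fwdDiff 1)^[2] q j) ≤ ε * D c) {t : ℝ}
    (ht : t ∈ Icc (0 : ℝ) 1) :
    dist (bezier n q t) (polyline n q t) ≤ ε * (NInfty n * ‖D‖) := by
  refine (dist_bezier_polyline_le hn q (ε • D) (fun c => mul_nonneg hε (hD c)) h ht).trans_eq ?_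
  rw [norm_smul, Real.norm_of_nonneg hε, mul_left_comm]

lemma dist_bezier_polyline_subdivide_le {n m : ℕ} (hn : 0 < n) (P : ℕ → ℕ → Space3) (i : ℕ) {k : ℕ}
    (hk : k < m * 2 ^ i) {t : ℝ} (ht : t ∈ Icc (0 : ℝ) 1) :
    dist (bezier n ((subdivide n)^[i] P k) t) (polyline n ((subdivide n)^[i] P k) t) ≤
      ((1 / 2) ^ 2) ^ i * (NInfty n * ‖secondDifference n m P‖) :=
  dist_bezier_polyline_le_of_fwdDiff_le hn (by positivity) (secondDifference_nonneg n m P)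
    (fun c j hj => seminorm_fwdDiff_iterate_subdivide_le (coordSeminorm c)
      (C := fun _ => secondDifference n m P c)
      (fun _ hk _ hj => coordSeminorm_fwdDiff_le P c hk hj) i k hk j hj) ht

lemma discreteDerivative_eq (n : ℕ) (a : ℕ → ℝ) (P : ℕ → ℕ → Space3) (k : ℕ) :
    discreteDerivative n a P k = ((a (k + 1) - a k) / n)⁻¹ • fwdDiff 1 (P k) := rfl

lemma fwdDiff_iterate_discreteDerivative (n d : ℕ) (a : ℕ → ℝ) (P : ℕ → ℕ → Space3) (k j : ℕ) :
    (fwdDiff 1)^[d] (discreteDerivative n a P k) j =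
      ((a (k + 1) - a k) / n)⁻¹ • (fwdDiff 1)^[d + 1] (P k) j := by
  rw [discreteDerivative_eq, fwdDiff_iter_const_smul, Function.iterate_succ_apply]
  rfl

/-- Differences of order `d` of the discrete derivative shrink at least by the factor `2 ^ d`
in each subdivision. -/
lemma seminorm_fwdDiff_discreteDerivative_le (ψ : Seminorm ℝ Space3) {n m d : ℕ} {a : ℕ → ℝ}
    (ha : IsPartition m a) (hn : 0 < n) {P : ℕ → ℕ → Space3} {C : ℝ}
    (h : ∀ k < m, ∀ j, j + d + 1 ≤ n → ψ ((fwdDiff 1)^[d] (discreteDerivative n a P k) j) ≤ C)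
    (i : ℕ) {k j : ℕ} (hk : k < m * 2 ^ i) (hj : j + d + 1 ≤ n) :
    ψ ((fwdDiff 1)^[d] (discreteDerivative n (bisect^[i] a) ((subdivide n)^[i] P) k) j) ≤
      ((1 / 2) ^ d) ^ i * C := by
  have hn' : (0 : ℝ) < n := by exact_mod_cast hn
  have hw : ∀ k < m, 0 < (a (k + 1) - a k) / n := fun k hk =>
    div_pos (sub_pos.2 (ha.lt k hk)) hn'
  -- Order `d + 1` differences of `P` lose `2 ^ (d + 1)` per step; division by the halved interval
  -- length returns one factor `2`.
  have h1 : ∀ k < m, ∀ j, j + (d + 1) ≤ n →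
      ψ ((fwdDiff 1)^[d + 1] (P k) j) ≤ (a (k + 1) - a k) / n * C := by
    intro k hk j hj
    have h2 := h k hk j hj
    rwa [fwdDiff_iterate_discreteDerivative, map_smul_eq_mul,
      Real.norm_of_nonneg (inv_nonneg.2 (hw k hk).le), inv_mul_le_iff₀ (hw k hk)] at h2
  have h3 := seminorm_fwdDiff_iterate_subdivide_le ψ h1 i k hk j hj
  have hk' : k / 2 ^ i < m := Nat.div_lt_of_lt_mul (by rwa [mul_comm])
  have h4 := hw _ hk'
  have h5 : 0 < (a (k / 2 ^ i + 1) - a (k / 2 ^ i)) / 2 ^ i / n :=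
    div_pos (div_pos (sub_pos.2 (ha.lt _ hk')) (by positivity)) hn'
  rw [fwdDiff_iterate_discreteDerivative, map_smul_eq_mul, bisect_iterate_sub,
    Real.norm_of_nonneg (inv_nonneg.2 h5.le), inv_mul_le_iff₀ h5]
  refine h3.trans_eq ?_
  rw [pow_succ, mul_pow, one_div_pow 2 i]
  ring

lemma IsCompositeBezier.velocity_eq {n m : ℕ} {a : ℕ → ℝ} {P : ℕ → ℕ → Space3} {γ : ℝ → Space3}
    (h : IsCompositeBezier (n + 1) m a P γ) (ha : IsPartition m a)
    (hγ : DifferentiableOn ℝ γ (Icc 0 1)) {k : ℕ} (hk : k < m) {s : ℝ} (hs : s ∈ Icc (0 : ℝ) 1) :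
    velocity γ (a k + s * (a (k + 1) - a k)) = bezier n (discreteDerivative (n + 1) a P k) s := by
  have hpos := sub_pos.2 (ha.lt k hk)
  have h1 := h.smul_velocity ha hγ hk hs
  rw [discreteDerivative_eq]
  refine Eq.trans ?_ (bezier_smul n _ (fwdDiff 1 (P k)) s).symm
  have h2 : (0 : ℝ) < (n : ℝ) + 1 := by positivity
  push_cast
  rw [inv_div, div_eq_inv_mul, mul_smul, ← h1, inv_smul_smul₀ hpos.ne']

lemma minSpeed_le (γ : ℝ → Space3) {t : ℝ} (ht : t ∈ Icc (0 : ℝ) 1) :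
    minSpeed γ ≤ ‖velocity γ t‖ :=
  csInf_le ⟨0, by rintro _ ⟨t, -, rfl⟩; exact norm_nonneg _⟩ (mem_image_of_mem _ ht)

/-- The point `q j` is the value of its polygon at `j / n`, and thus close to the velocity there,
whose norm is at least `σ`. -/
lemma IsCompositeBezier.minSpeed_sub_le_norm_discreteDerivative {n m : ℕ} (hn : 0 < n) {a : ℕ → ℝ}
    {P : ℕ → ℕ → Space3} {γ : ℝ → Space3} (h : IsCompositeBezier (n + 1) m a P γ)
    (ha : IsPartition m a) (hγ : DifferentiableOn ℝ γ (Icc 0 1)) (i : ℕ) {k j : ℕ}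
    (hk : k < m * 2 ^ i) (hj : j ≤ n) :
    minSpeed γ - ((1 / 2) ^ 2) ^ i *
        (NInfty n * ‖secondDifference n m (discreteDerivative (n + 1) a P)‖) ≤
      ‖discreteDerivative (n + 1) (bisect^[i] a) ((subdivide (n + 1))^[i] P) k j‖ := by
  set q := discreteDerivative (n + 1) (bisect^[i] a) ((subdivide (n + 1))^[i] P) k with hq
  have hn' : (0 : ℝ) < n := by exact_mod_cast hn
  have hjn : (j : ℝ) ≤ n := by exact_mod_cast hj
  have ht : (j : ℝ) / n ∈ Icc (0 : ℝ) 1 := ⟨by positivity, (div_le_one hn').2 hjn⟩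
  have h1 := dist_bezier_polyline_le_of_fwdDiff_le hn (q := q) (ε := ((1 / 2) ^ 2) ^ i)
    (by positivity) (secondDifference_nonneg n m (discreteDerivative (n + 1) a P))
    (fun c j hj => seminorm_fwdDiff_discreteDerivative_le (coordSeminorm c) ha n.succ_pos
      (fun k hk j hj => coordSeminorm_fwdDiff_le _ c hk (by omega)) i hk (by omega)) ht
  have h2 : polyline n q (j / n) = q j := by
    rw [polyline_apply q j (f := 0) (by simp) (by field_simp; simp)]
    simp
  have h3 := minSpeed_le γ ((ha.bisect_iterate i).mem_Icc hk ht)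
  rw [(h.subdivide_iterate i).velocity_eq (ha.bisect_iterate i) hγ hk ht] at h3
  rw [h2, dist_eq_norm] at h1
  have h4 := norm_sub_norm_le (bezier n q (j / n)) (q j)
  linarith

lemma norm_discreteDerivative_sub_le {n m : ℕ} {a : ℕ → ℝ} (ha : IsPartition m a)
    (P : ℕ → ℕ → Space3) (i : ℕ) {k j : ℕ} (hk : k < m * 2 ^ i) (hj : j < n) :
    ‖discreteDerivative (n + 1) (bisect^[i] a) ((subdivide (n + 1))^[i] P) k j -
        discreteDerivative (n + 1) (bisect^[i] a) ((subdivide (n + 1))^[i] P) k (j + 1)‖ ≤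
      (1 / 2) ^ i * maxStep (n + 1) m a P := by
  have h := seminorm_fwdDiff_discreteDerivative_le (normSeminorm ℝ Space3) (d := 1) ha n.succ_pos
    (P := P) (C := maxStep (n + 1) m a P) (fun k hk j hj => ?_) i hk
    (show j + 1 + 1 ≤ n + 1 by omega)
  · rw [norm_sub_rev]
    simpa [fwdDiff] using h
  · refine le_trans (le_of_eq ?_) (le_ciSup (f := fun q : Fin m × Fin (n + 1 - 1) =>
      dist (discreteDerivative (n + 1) a P q.1 q.2) (discreteDerivative (n + 1) a P q.1 (q.2 + 1)))
      (Set.finite_range _).bddAbove (⟨k, hk⟩, ⟨j, by omega⟩))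
    rw [dist_comm, dist_eq_norm]
    rfl

/-- The case `x = 0` absorbs the default value `logb 2 0 = 0`. -/
lemma le_two_pow_of_logb_le {x : ℝ} {i : ℕ} (hx : 0 ≤ x) (h : Real.logb 2 x ≤ i) : x ≤ 2 ^ i := by
  rcases hx.eq_or_lt with rfl | hx
  · positivity
  · rwa [Real.logb_le_iff_le_rpow one_lt_two hx, Real.rpow_natCast] at h

lemma maxStep_nonneg (n m : ℕ) (a : ℕ → ℝ) (P : ℕ → ℕ → Space3) : 0 ≤ maxStep n m a P :=
  Real.iSup_nonneg fun _ => dist_nonneg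

/-- After sufficiently many subdivisions, the edges of each control polygon are pairwise at acute
angles. -/
lemma IsCompositeBezier.inner_subdivide_pos {n m : ℕ} (hn : 0 < n) {a : ℕ → ℝ}
    {P : ℕ → ℕ → Space3} {γ : ℝ → Space3} (h : IsCompositeBezier (n + 1) m a P γ)
    (ha : IsPartition m a) (hγ : DifferentiableOn ℝ γ (Icc 0 1)) {N₁ : ℝ}
    (hN₁ : derivDistBound (n + 1) m a P N₁ < minSpeed γ) {i : ℕ} (hi : N₁ ≤ i)
    (hi' : Real.logb 2 (angleFactor (n + 1) m a P γ N₁ (Real.pi / (2 * n))) ≤ i) {k j l : ℕ}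
    (hk : k < m * 2 ^ i) (hj : j < n + 1) (hl : l < n + 1) :
    0 < inner ℝ ((subdivide (n + 1))^[i] P k (j + 1) - (subdivide (n + 1))^[i] P k j)
      ((subdivide (n + 1))^[i] P k (l + 1) - (subdivide (n + 1))^[i] P k l) := by
  set ν := Real.pi / (2 * n) with hν
  set s := minSpeed γ - derivDistBound (n + 1) m a P N₁ with hs
  have hs0 : 0 < s := sub_pos.2 hN₁
  have hn1 : (1 : ℝ) ≤ n := by exact_mod_cast hn
  have hν0 : 0 < ν := div_pos Real.pi_pos (by linarith)
  have hν1 : ν ≤ Real.pi / 2 := by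
    have := Real.pi_pos
    rw [hν]
    gcongr
    linarith
  have hcos : 0 < 1 - Real.cos ν := by
    have := Real.cos_lt_cos_of_nonneg_of_le_pi_div_two le_rfl hν1 hν0
    rw [Real.cos_zero] at this
    linarith
  have hM := maxStep_nonneg (n + 1) m a P
  have hf := le_two_pow_of_logb_le (by rw [angleFactor]; positivity) hi'
  rw [angleFactor, ← hs, div_le_iff₀ (mul_pos hcos hs0)] at hf
  -- This is `f(ν) ≤ 2 ^ i` solved for `M`.
  have hstep : (1 / 2) ^ i * maxStep (n + 1) m a P ≤ (1 - Real.cos ν) * s / 2 := by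
    rw [one_div_pow, one_div, inv_mul_le_iff₀ (by positivity)]
    linarith
  have hspeed : ∀ j ≤ n,
      s ≤ ‖discreteDerivative (n + 1) (bisect^[i] a) ((subdivide (n + 1))^[i] P) k j‖ := by
    intro j hj
    refine le_trans ?_ (h.minSpeed_sub_le_norm_discreteDerivative hn ha hγ i hk hj)
    rw [hs, derivDistBound]
    -- As `N₁ ≤ i`, the bound after `i` subdivisions is at most `B'_dist(N₁)`.
    have hpow : ((1 / 2 : ℝ) ^ 2) ^ i ≤ 1 / (2 : ℝ) ^ (2 * N₁) := by
      rw [← pow_mul, one_div_pow, ← Real.rpow_natCast]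
      gcongr
      · exact one_le_two
      · push_cast
        linarith
    have hX : 0 ≤ NInfty n * ‖secondDifference n m (discreteDerivative (n + 1) a P)‖ :=
      mul_nonneg (nInfty_nonneg n) (norm_nonneg _)
    have := mul_le_mul_of_nonneg_right hpow hX
    exact sub_le_sub_left this _
  have hpos := inner_pos_of_consecutive hn
    (e := discreteDerivative (n + 1) (bisect^[i] a) ((subdivide (n + 1))^[i] P) k)
    (fun j hj => norm_pos_iff.1 (hs0.trans_le (hspeed j hj)))
    (fun j hj => angle_lt_of_norm_sub_le hs0 hν0 hν1 (hspeed j hj.le) (hspeed (j + 1) hj)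
      ((norm_discreteDerivative_sub_le ha P i hk hj).trans hstep))
    (Nat.lt_succ_iff.1 hj) (Nat.lt_succ_iff.1 hl)
  -- Within one segment all edges are scaled by the same factor, so its square drops out.
  rw [discreteDerivative, discreteDerivative, real_inner_smul_left, real_inner_smul_right,
    ← mul_assoc] at hpos
  exact pos_of_mul_pos_right hpos (mul_self_nonneg _)

lemma mul_le_of_distIterations_le {n m : ℕ} {P : ℕ → ℕ → Space3} {r : ℝ} (hr : 0 < r) {i : ℕ}
    (h : distIterations n m P r ≤ i) :
    ((1 / 2) ^ 2) ^ i * (NInfty n * ‖secondDifference n m P‖) ≤ r := by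
  have hX : 0 ≤ NInfty n * ‖secondDifference n m P‖ :=
    mul_nonneg (nInfty_nonneg n) (norm_nonneg _)
  -- The factor `1 / 2` in `N'(r)` becomes the exponent `2 * i`.
  have h1 := le_two_pow_of_logb_le (i := 2 * i) (div_nonneg hX hr.le) (by
    rw [distIterations] at h
    push_cast
    linarith)
  rw [div_le_iff₀ hr] at h1
  rw [← pow_mul, one_div_pow, one_div, inv_mul_le_iff₀ (by positivity)]
  exact h1

/-! ### Conclusion -/

/-- A simple curve can identify only `0` with `1`, and whether it does depends on its end points
alone. -/
lemma IsSimpleCurve.eq_iff {γ δ : ℝ → Space3} (hγ : IsSimpleCurve γ) (hδ : IsSimpleCurve δ)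
    (h0 : γ 0 = δ 0) (h1 : γ 1 = δ 1) :
    ∀ s ∈ Icc (0 : ℝ) 1, ∀ t ∈ Icc (0 : ℝ) 1, γ s = γ t ↔ δ s = δ t := by
  have key : ∀ {γ δ : ℝ → Space3}, IsSimpleCurve γ → γ 0 = δ 0 → γ 1 = δ 1 →
      ∀ s ∈ Icc (0 : ℝ) 1, ∀ t ∈ Icc (0 : ℝ) 1, γ s = γ t → δ s = δ t := by
    intro γ δ hγ h0 h1 s hs t ht heq
    rcases lt_trichotomy s t with hst | rfl | hst
    · obtain ⟨rfl, rfl⟩ := hγ s hs t ht hst heq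
      rw [← h0, ← h1, heq]
    · rfl
    · obtain ⟨rfl, rfl⟩ := hγ t ht s hs hst heq.symm
      rw [← h0, ← h1, heq]
  exact fun s hs t ht => ⟨key hγ h0 h1 s hs t ht, key hδ h0.symm h1.symm s hs t ht⟩

theorem mainTheorem5 (n m : ℕ) (hn : 2 ≤ n) (a : ℕ → ℝ) (ha : IsPartition m a)
    (P : ℕ → ℕ → Space3) (γ : ℝ → Space3) (hγ : IsCompositeBezier n m a P γ)
    (hC1 : ContDiffOn ℝ 1 γ (Set.Icc 0 1)) (hreg : IsRegularCurve γ) (hsimple : IsSimpleCurve γ)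
    (r : ℝ) (hr : 0 < r) (hpipe : PipeNonSelfIntersecting γ r)
    (N₁ : ℝ) (hN₁ : derivDistBound n m a P N₁ < minSpeed γ)
    (i : ℕ) (hi : ⌈homeoIterations n m a P γ N₁ r⌉ ≤ (i : ℤ)) :
    IsSimpleCurve (controlPolygon n m P i) ∧
      Nonempty ((controlPolygon n m P i '' Set.Icc 0 1) ≃ₜ (γ '' Set.Icc 0 1)) := by
  -- From here on `n` is the degree of the velocity, the original `n - 1`.
  obtain ⟨n, rfl⟩ : ∃ d, n = d + 1 := ⟨n - 1, by omega⟩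
  have hdiff : DifferentiableOn ℝ γ (Icc 0 1) := hC1.differentiableOn one_ne_zero
  have hi₀ : homeoIterations (n + 1) m a P γ N₁ r ≤ i := by exact_mod_cast Int.ceil_le.1 hi
  have hi₁ : (angleIterations (n + 1) m a P γ N₁ (Real.pi / (2 * n)) : ℝ) ≤ i := by
    have := (le_max_left _ _).trans hi₀
    simpa using this
  have hi₂ := (Int.le_ceil _).trans hi₁
  have ha' := ha.bisect_iterate i
  have hγ' := hγ.subdivide_iterate i
  have hsimple' : IsSimpleCurve (controlPolygon (n + 1) m P i) :=
    hγ'.isSimpleCurve_polyline ha' hdiff hpipe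
      (fun k hk j hj l hl => hγ.inner_subdivide_pos (by omega) ha hdiff hN₁
        ((le_max_left _ _).trans hi₂) ((le_max_right _ _).trans hi₂) hk hj hl)
      (fun k hk t ht => (dist_bezier_polyline_subdivide_le n.succ_pos P i hk ht).trans
        (mul_le_of_distIterations_le hr ((le_max_right _ _).trans hi₀)))
  have hm := ha'.pos
  refine ⟨hsimple', nonempty_homeomorph_image isCompact_Icc
    (continuousOn_polyline (Nat.mul_pos n.succ_pos hm) _) hC1.continuousOn
    (hsimple'.eq_iff hsimple ?_ ?_)⟩
  · have h0 := hγ' 0 hm 0 (by simp)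
    rw [ha'.first, zero_mul, add_zero, bezier_zero] at h0
    rw [h0, controlPolygon, polyline_zero]
    simpa using hγ'.vertices_apply n.succ_pos hm (Nat.zero_le _)
  · have hm1 : m * 2 ^ i - 1 + 1 = m * 2 ^ i := Nat.sub_add_cancel hm
    have h1 := hγ' (m * 2 ^ i - 1) (by omega) 1 (by simp)
    rw [one_mul, add_sub_cancel, bezier_one, hm1, ha'.last] at h1
    rw [h1, controlPolygon, polyline_one, vertices, if_neg (lt_irrefl _)]
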